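/- **Setting.** Let $\mu,\sigma,k,\psi:\mathbb R\to\mathbb R$ satisfy: $\mu$ is measurable, even, and positive and differentiable on $(0,\infty)$; $\sigma$ is even, continuous, and $|\sigma|$ is bounded away from zero on $(\varepsilon,\infty)$ for every $\varepsilon>0$; for some $A\ge 0$, $\mu'(y)\sigma^2(y)=A\mu^2(y)$ for all $y\ge 0$ (at $y=0$ with the right derivative, whenever it exists); if $A=0$ then $\sigma$ is bounded, and if $A>0$ then $|\mu'|$ is bounded away from zero on $(\varepsilon,\infty)$ for every $\varepsilon>0$; $k$ and $\psi$ are $C^2$, non-negative, even and strictly convex, $\psi(0)=0$, and $\psi'(y)\to\infty$ as $y\to\infty$. For $x\in\mathbb R$ let $\mathcal A(x)$ be the collection of all weak solutions $\big((\Omega,\mathcal F,\mathbb P),\mathbb F,W,u,X\big)$, consisting of a filtered probability space, an $\mathbb F$-Brownian motion $W$, an $\mathbb F$-progressively measurable control $u$ and an $\mathbb F$-adapted process $X$ such that almost surely, for all $t\ge0$, $\int_0^t\big[|u(r)\mu(X(r))|+\sigma^2(X(r))\big]\,dr<\infty$ and $$X(t)=x+\int_0^t u(r)\mu(X(r))\,dr+\int_0^t\sigma(X(r))\,dW(r).$$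 We write $X\in\mathcal A(x)$ for such a quintuple. Let $\mathcal T^X$ be the set of all $[0,\infty]$-valued stopping times of the filtration generated by $X$ and, for $\alpha\in[0,\infty)$, let $\mathcal T^X_\alpha=\{\tau\in\mathcal T^X:\mathbb E[\tau]\le\alpha\}$. For $X\in\mathcal A(x)$, $\tau\in\mathcal T^X$ and $c\in[0,\infty)$ put $$J(x,X,\tau,c)=\mathbb E\Big[k(X(\tau))+\int_0^\tau\psi(u(t))\,dt+c\tau\Big]\in[0,\infty],$$ where the terminal cost is taken to be $+\infty$ on $\{\tau=\infty\}$ (which matters only if $c=0$), and define $$V_\alpha(x,c)=\inf_{X\in\mathcal A(x),\,\tau\in\mathcal T^X_\alpha}J(x,X,\tau,c),\qquad \Psi_\alpha(x,c)=\sup_{\lambda\ge0}\ \inf_{X\in\mathcal A(x),\,\tau\in\mathcal T^X}\big(J(x,X,\tau,c+\lambda)-\lambda\alpha\big).$$ **Proposition.** Fix $x\in\mathbb R$ and $c,\alpha\in[0,\infty)$. Suppose that $X^\dagger\in\mathcal A(x)$, $\tau^\dagger\in\mathcal T^{X^\dagger}$ and $\bar\lambda\in[0,\infty)$ satisfy $\mathbb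 E[\tau^\dagger]\le\alpha$, the complementary slackness condition $\bar\lambda(\alpha-\mathbb E[\tau^\dagger])=0$, and $$\inf_{X\in\mathcal A(x),\,\tau\in\mathcal T^X}J(x,X,\tau,c+\bar\lambda)=J(x,X^\dagger,\tau^\dagger,c+\bar\lambda),$$ that is, $(X^\dagger,\tau^\dagger)$ is optimal for the unconstrained problem with cost $c+\bar\lambda$ per unit of time. Then $(X^\dagger,\tau^\dagger)$ is optimal for the constrained problem, that is, $\tau^\dagger\in\mathcal T^{X^\dagger}_\alpha$ and $J(x,X^\dagger,\tau^\dagger,c)=V_\alpha(x,c)$. Moreover, there is no duality gap: $\Psi_\alpha(x,c)=V_\alpha(x,c)$. -/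

import Mathlib

open MeasureTheory ProbabilityTheory Filter Topology
open scoped NNReal ENNReal

universe u

noncomputable section

/-- The coefficients `μ`, `σ` of the controlled diffusion and the cost functions `k` (terminal
cost) and `ψ` (running cost of control), with the standing assumptions on them. -/
structure ControlModel where
  μ : ℝ → ℝ
  σ : ℝ → ℝ
  k : ℝ → ℝ
  ψ : ℝ → ℝ
  /-- The constant in the relation `μ' σ² = A μ²`. -/
  A : ℝ
  measurable_μ : Measurable μ
  even_μ : ∀ y, μ (-y) = μ y
  pos_μ : ∀ y, 0 < y → 0 < μ y
  differentiable_μ : ∀ y, 0 < y → DifferentiableAt ℝ μ y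
  even_σ : ∀ y, σ (-y) = σ y
  continuous_σ : Continuous σ
  away_σ : ∀ ε > 0, ∃ δ > 0, ∀ y, ε < y → δ ≤ |σ y|
  A_nonneg : 0 ≤ A
  /-- `μ' σ² = A μ²` on `[0, ∞)`. Since `μ` is assumed differentiable on `(0, ∞)` only, at the
  origin the relation is about the right derivative, if there is one. -/
  relation : ∀ y, 0 ≤ y → ∀ d, HasDerivWithinAt μ d (Set.Ici 0) y → d * σ y ^ 2 = A * μ y ^ 2
  growth_zero : A = 0 → ∃ M, ∀ y, |σ y| ≤ M
  growth_pos : 0 < A → ∀ ε > 0, ∃ δ > 0, ∀ y, ε < y → δ ≤ |deriv μ y|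
  contDiff_k : ContDiff ℝ 2 k
  nonneg_k : ∀ y, 0 ≤ k y
  even_k : ∀ y, k (-y) = k y
  strictConvex_k : StrictConvexOn ℝ Set.univ k
  contDiff_ψ : ContDiff ℝ 2 ψ
  nonneg_ψ : ∀ y, 0 ≤ ψ y
  even_ψ : ∀ y, ψ (-y) = ψ y
  strictConvex_ψ : StrictConvexOn ℝ Set.univ ψ
  ψ_zero : ψ 0 = 0
  deriv_ψ_tendsto : Tendsto (deriv ψ) atTop atTop

/-- Lebesgue measure on the time axis `[0, ∞)`. -/
def timeMeasure : Measure ℝ≥0 :=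
  (volume : Measure ℝ).comap ((↑) : ℝ≥0 → ℝ)

/-! ### Brownian motion relative to a filtration, and the Itô integral -/

section Ito

variable {Ω : Type u} [mΩ : MeasurableSpace Ω]

/-- `W` is a Brownian motion of the filtration `F`: a Brownian motion, adapted to `F`, whose
increments after time `s` are independent of `F s`. -/
structure IsFiltrationBrownian (P : Measure Ω) (F : Filtration ℝ≥0 mΩ) (W : ℝ≥0 → Ω → ℝ) :
    Prop where
  isBrownian : IsBrownianReal W P
  adapted : Adapted F W
  indep : ∀ s t : ℝ≥0, s ≤ t →
    Indep (F s) (MeasurableSpace.comap (fun ω => W t ω - W s ω) inferInstance) P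

/-- Simple integrands `∑ i < n, ξ i · 1_{(t i, t (i+1)]}`, with `t` nondecreasing and each `ξ i`
bounded and `F (t i)`-measurable. -/
structure SimpleIntegrand (F : Filtration ℝ≥0 mΩ) where
  n : ℕ
  t : ℕ → ℝ≥0
  ξ : ℕ → Ω → ℝ
  mono : Monotone t
  measurable : ∀ i, Measurable[F (t i)] (ξ i)
  bounded : ∀ i, ∃ C, ∀ ω, |ξ i ω| ≤ C

/-- The values of a simple integrand. -/
def SimpleIntegrand.eval {F : Filtration ℝ≥0 mΩ} (S : SimpleIntegrand F) (r : ℝ≥0) (ω : Ω) : ℝ :=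
  ∑ i ∈ Finset.range S.n, (Set.Ioc (S.t i) (S.t (i + 1))).indicator (fun _ => S.ξ i ω) r

/-- The elementary stochastic integral
`∫₀ʳ S dW = ∑ i < n, ξ i (W (t (i+1) ∧ r) - W (t i ∧ r))`. -/
def SimpleIntegrand.integral {F : Filtration ℝ≥0 mΩ} (S : SimpleIntegrand F)
    (W : ℝ≥0 → Ω → ℝ) (r : ℝ≥0) (ω : Ω) : ℝ :=
  ∑ i ∈ Finset.range S.n, S.ξ i ω * (W (min (S.t (i + 1)) r) ω - W (min (S.t i) r) ω)

/-- `M` is (a continuous version of) the Itô integral `∫₀ H dW`: there are simple integrands `S m`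
with `∫₀ᵀ (S m - H)² dr → 0` in probability for each `T`, such that the elementary integrals
of the `S m` converge to `M` in probability, uniformly on each `[0, T]`. -/
def IsItoIntegral (P : Measure Ω) (F : Filtration ℝ≥0 mΩ) (W H M : ℝ≥0 → Ω → ℝ) : Prop :=
  (∀ᵐ ω ∂P, Continuous fun t => M t ω) ∧
  ∃ S : ℕ → SimpleIntegrand F,
    (∀ T : ℝ≥0, ∀ ε : ℝ≥0∞, 0 < ε →
      Tendsto (fun m => P {ω | ε ≤ ∫⁻ r in Set.Icc 0 T,
        ENNReal.ofReal (((S m).eval r ω - H r ω) ^ 2) ∂timeMeasure}) atTop (𝓝 0)) ∧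
    (∀ T : ℝ≥0, ∀ ε : ℝ≥0∞, 0 < ε →
      Tendsto (fun m => P {ω | ε ≤ ⨆ r ∈ Set.Icc 0 T,
        ENNReal.ofReal |(S m).integral W r ω - M r ω|}) atTop (𝓝 0))

end Ito

/-! ### Admissible processes, stopping times, and the control problems -/

/-- The collection `𝒜(x)`: weak solutions `((Ω, ℱ, P), F, W, u, X)` of
`X t = x + ∫₀ᵗ u μ(X) dr + ∫₀ᵗ σ(X) dW`. -/
structure Admissible (D : ControlModel) (x : ℝ) where
  Ω : Type u
  mΩ : MeasurableSpace Ω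
  P : Measure Ω
  isProbabilityMeasure : IsProbabilityMeasure P
  F : Filtration ℝ≥0 mΩ
  W : ℝ≥0 → Ω → ℝ
  u : ℝ≥0 → Ω → ℝ
  X : ℝ≥0 → Ω → ℝ
  brownian : IsFiltrationBrownian P F W
  progressive_u : IsProgressive F u
  adapted_X : Adapted F X
  integrable : ∀ᵐ ω ∂P, ∀ t : ℝ≥0,
    ∫⁻ r in Set.Icc 0 t, ENNReal.ofReal (|u r ω * D.μ (X r ω)| + D.σ (X r ω) ^ 2) ∂timeMeasure < ∞
  sde : ∃ M : ℝ≥0 → Ω → ℝ, IsItoIntegral P F W (fun r ω => D.σ (X r ω)) M ∧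
    ∀ᵐ ω ∂P, ∀ t : ℝ≥0,
      X t ω = x + (∫ r in Set.Icc 0 t, u r ω * D.μ (X r ω) ∂timeMeasure) + M t ω

namespace Admissible

variable {D : ControlModel} {x : ℝ}

attribute [instance] Admissible.mΩ Admissible.isProbabilityMeasure

/-- The filtration generated by the state process `X`. -/
def stateFiltration (X : Admissible.{u} D x) : Filtration ℝ≥0 X.mΩ :=
  Filtration.natural X.X fun t => (X.adapted_X.measurable (i := t)).stronglyMeasurable

/-- `𝒯^X`: the stopping times, with values in `[0, ∞]`, of the filtration generated by `X`. -/
def stoppingTimes (X : Admissible.{u} D x) : Set (X.Ω → ℝ≥0∞) :=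
  {τ | IsStoppingTime X.stateFiltration τ}

/-- The expectation `E[τ] ∈ [0, ∞]`. -/
def expectedTime (X : Admissible.{u} D x) (τ : X.Ω → ℝ≥0∞) : ℝ≥0∞ :=
  ∫⁻ ω, τ ω ∂X.P

/-- `𝒯^X_α`: the stopping times of the filtration generated by `X` with `E[τ] ≤ α`. -/
def stoppingTimesLE (X : Admissible.{u} D x) (α : ℝ≥0) : Set (X.Ω → ℝ≥0∞) :=
  {τ | τ ∈ X.stoppingTimes ∧ X.expectedTime τ ≤ α}

open Classical in
/-- The terminal cost `k (X τ)`. It is infinite where `τ = ∞`, that is, never stopping is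
prohibited; if `c > 0`, the total cost is infinite there anyway. -/
def terminalCost (X : Admissible.{u} D x) (τ : X.Ω → ℝ≥0∞) (ω : X.Ω) : ℝ≥0∞ :=
  if τ ω = ∞ then ∞ else ENNReal.ofReal (D.k (X.X (τ ω).toNNReal ω))

/-- The total expected cost `J(x, X, τ, c) = E[k(X τ) + ∫₀^τ ψ(u t) dt + c τ] ∈ [0, ∞]`. -/
def cost (X : Admissible.{u} D x) (τ : X.Ω → ℝ≥0∞) (c : ℝ≥0) : ℝ≥0∞ :=
  ∫⁻ ω, (X.terminalCost τ ω
    + (∫⁻ t in {t : ℝ≥0 | (t : ℝ≥0∞) ≤ τ ω}, ENNReal.ofReal (D.ψ (X.u t ω)) ∂timeMeasure)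
    + (c : ℝ≥0∞) * τ ω) ∂X.P

end Admissible

/-- The value of the unconstrained problem with cost `c` per unit of time. -/
def unconstrainedValue (D : ControlModel) (x : ℝ) (c : ℝ≥0) : ℝ≥0∞ :=
  ⨅ (X : Admissible.{u} D x) (τ ∈ X.stoppingTimes), X.cost τ c

/-- The value `V_α(x, c)` of the constrained (primal) problem. -/
def constrainedValue (D : ControlModel) (x : ℝ) (α c : ℝ≥0) : ℝ≥0∞ :=
  ⨅ (X : Admissible.{u} D x) (τ ∈ X.stoppingTimesLE α), X.cost τ c

/-- The value `Ψ_α(x, c) = sup_{l ≥ 0} inf_{X, τ} (J(x, X, τ, c + l) - l α)` of the dual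
problem. -/
def dualValue (D : ControlModel) (x : ℝ) (α c : ℝ≥0) : EReal :=
  ⨆ l : ℝ≥0, ⨅ (X : Admissible.{u} D x) (τ ∈ X.stoppingTimes),
    ((X.cost τ (c + l) : EReal) - ((l * α : ℝ) : EReal))

end

namespace Admissible

variable {D : ControlModel} {x : ℝ}

/-! The argument is Lagrangian. Charging `l` more per unit of time adds exactly `l * E[τ]` to the
cost (`cost_add`), hence at most `l * α` under the constraint (`cost_add_le`). By slackness the
candidate pays exactly `l * α`. Its optimality for the penalised problem therefore survives
subtracting `l * α`, against every constrained competitor. The same bound gives weak duality, and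
the multiplier `l` itself attains equality in the dual. -/

lemma measurable_of_mem_stoppingTimes (X : Admissible.{u} D x) {τ : X.Ω → ℝ≥0∞}
    (hτ : τ ∈ X.stoppingTimes) : Measurable τ := by
  refine measurable_of_Iic fun a => ?_
  induction a using ENNReal.recTopCoe with
  | top => simp
  | coe t => exact X.stateFiltration.le t _ (hτ t)

/-- The cost of time enters the total expected cost linearly. -/
lemma cost_add (X : Admissible.{u} D x) {τ : X.Ω → ℝ≥0∞} (hτ : τ ∈ X.stoppingTimes)
    (c l : ℝ≥0) : X.cost τ (c + l) = X.cost τ c + l * X.expectedTime τ := by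
  have hm := X.measurable_of_mem_stoppingTimes hτ
  unfold cost expectedTime
  -- The integral splits once one summand is measurable; here it is the time cost, so the terminal
  -- and running costs need no measurability.
  rw [← lintegral_const_mul _ hm, ← lintegral_add_right _ (hm.const_mul _)]
  simp only [ENNReal.coe_add, add_mul, add_assoc]

lemma cost_add_le (X : Admissible.{u} D x) {α : ℝ≥0} {τ : X.Ω → ℝ≥0∞}
    (hτ : τ ∈ X.stoppingTimesLE α) (c l : ℝ≥0) :
    X.cost τ (c + l) ≤ X.cost τ c + (l * α : ℝ≥0) := by
  rw [X.cost_add hτ.1, ENNReal.coe_mul]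
  gcongr
  exact hτ.2

end Admissible

lemma unconstrainedValue_le_cost {D : ControlModel} {x : ℝ} (X : Admissible.{u} D x)
    {τ : X.Ω → ℝ≥0∞} (hτ : τ ∈ X.stoppingTimes) (c : ℝ≥0) :
    unconstrainedValue.{u} D x c ≤ X.cost τ c :=
  iInf_le_of_le X (iInf₂_le τ hτ)

lemma constrainedValue_le_cost {D : ControlModel} {x : ℝ} (X : Admissible.{u} D x) {α : ℝ≥0}
    {τ : X.Ω → ℝ≥0∞} (hτ : τ ∈ X.stoppingTimesLE α) (c : ℝ≥0) :
    constrainedValue.{u} D x α c ≤ X.cost τ c :=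
  iInf_le_of_le X (iInf₂_le τ hτ)

/-- Cancellation holds even for `a = ∞`, because `l * α` is finite. This links costs in `[0, ∞]` to
the dual, whose penalised values may be negative. -/
lemma EReal.coe_ennreal_add_coe_sub (a : ℝ≥0∞) (l α : ℝ≥0) :
    ((a + (l * α : ℝ≥0) : ℝ≥0∞) : EReal) - ((l * α : ℝ) : EReal) = a := by
  have h : (((l * α : ℝ≥0) : ℝ≥0∞) : EReal) = ((l * α : ℝ) : EReal) := rfl
  rw [EReal.coe_ennreal_add, h, EReal.add_sub_cancel_right]

/-- Weak duality, for a value attained at an element of the constrained class. -/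
lemma dualValue_le_cost {D : ControlModel} {x : ℝ} (X : Admissible.{u} D x) {α : ℝ≥0}
    {τ : X.Ω → ℝ≥0∞} (hτ : τ ∈ X.stoppingTimesLE α) (c : ℝ≥0) :
    dualValue.{u} D x α c ≤ (X.cost τ c : EReal) := by
  refine iSup_le fun l => iInf_le_of_le X (iInf₂_le_of_le τ hτ.1 ?_)
  rw [← EReal.coe_ennreal_add_coe_sub (X.cost τ c) l α]
  exact EReal.sub_le_sub (EReal.coe_ennreal_le_coe_ennreal_iff.2 (X.cost_add_le hτ c l)) le_rfl

lemma unconstrainedValue_sub_le_dualValue (D : ControlModel) (x : ℝ) (α c l : ℝ≥0) :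
    (unconstrainedValue.{u} D x (c + l) : EReal) - ((l * α : ℝ) : EReal)
      ≤ dualValue.{u} D x α c :=
  le_iSup_of_le l <| le_iInf fun X => le_iInf₂ fun _ hτ =>
    EReal.sub_le_sub
      (EReal.coe_ennreal_le_coe_ennreal_iff.2 (unconstrainedValue_le_cost X hτ (c + l))) le_rfl

theorem proposition2 (D : ControlModel) (x : ℝ) (c α : ℝ≥0)
    (X : Admissible.{u} D x) (τ : X.Ω → ℝ≥0∞) (hτ : τ ∈ X.stoppingTimes)
    (l : ℝ≥0)
    (hα : X.expectedTime τ ≤ α)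
    (hslack : (l : ℝ) * ((α : ℝ) - (X.expectedTime τ).toReal) = 0)
    (hopt : unconstrainedValue.{u} D x (c + l) = X.cost τ (c + l)) :
    (τ ∈ X.stoppingTimesLE α ∧ X.cost τ c = constrainedValue.{u} D x α c) ∧
      dualValue.{u} D x α c = (constrainedValue.{u} D x α c : EReal) := by
  have hmem : τ ∈ X.stoppingTimesLE α := ⟨hτ, hα⟩
  have hmul : (l : ℝ≥0∞) * X.expectedTime τ = (l * α : ℝ≥0) := by
    -- Slackness is stated through `toReal`, which sends `∞` to `0`; the bound by `α` makes `E[τ]`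
    -- finite, so nothing is lost.
    lift X.expectedTime τ to ℝ≥0 using ne_top_of_le_ne_top ENNReal.coe_ne_top hα with e
    rw [← ENNReal.coe_mul, ENNReal.coe_inj, ← NNReal.coe_inj, NNReal.coe_mul, NNReal.coe_mul]
    rw [ENNReal.coe_toReal] at hslack
    linarith
  have hval : unconstrainedValue.{u} D x (c + l) = X.cost τ c + (l * α : ℝ≥0) := by
    rw [hopt, X.cost_add hτ, hmul]
  have hprimal : X.cost τ c = constrainedValue.{u} D x α c := by
    refine le_antisymm (le_iInf fun Y => le_iInf₂ fun ρ hρ => ?_)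
      (constrainedValue_le_cost X hmem c)
    -- Adding the finite `l * α` to both sides avoids truncated subtraction and turns the left side
    -- into the unconstrained value.
    refine (ENNReal.add_le_add_iff_right (ENNReal.coe_ne_top (r := l * α))).1 ?_
    rw [← hval]
    exact (unconstrainedValue_le_cost Y hρ.1 (c + l)).trans (Y.cost_add_le hρ c l)
  refine ⟨⟨hmem, hprimal⟩, ?_⟩
  rw [← hprimal]
  refine le_antisymm (dualValue_le_cost X hmem c) ?_
  -- The candidate's cost is the dual objective at the given multiplier, one of the terms of the
  -- supremum.
  rw [← EReal.coe_ennreal_add_coe_sub (X.cost τ c) l α, ← hval]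
  exact unconstrainedValue_sub_le_dualValue D x α c l
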